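/- **Setting.** A dataset is a finite multiset $D$ of elements of a set $X$. Two multisets (or two lists) are *adjacent* if one of them is obtained from the other by inserting a single element. A randomized algorithm $\mathcal A$ on datasets is $(\varepsilon,\delta)$-DP if $\Pr[\mathcal A(D)\in F]\le e^{\varepsilon}\Pr[\mathcal A(D')\in F]+\delta$ for all adjacent $D,D'$ and all measurable sets $F$ of outcomes. A deterministic map $E$ from multisets to lists is *adjacency preserving* if $E(D)$ and $E(D')$ are equal or adjacent lists whenever $D,D'$ are adjacent. **Algorithm (Reorder-Slice-Compute).** Let $0<\varepsilon<1$, $0\le\delta<1$, let $\tau\ge 1$ and $0\le \ell\le\tau$ be integers, let $D$ be the input dataset, and put $D_0=D$. *Slice and compute.* For $i=1,\dots,\tau$: receive an integer $m_i\ge 0$, an $(\varepsilon,\delta)$-DP algorithm $\mathcal A_i$ and an adjacency-preserving map $E_i$; draw independently $g_i$ with $\Pr[g_i=k]=e^{-\varepsilon k}(1-e^{-\varepsilon})$, $k\ge 0$; let the slice $S_i$ consist of the first $m_i+g_i$ elements of the list $E_i(D_{i-1})$ (of all its elements if there are fewer) and let $D_i$ be the multiset of its remaining elements; publish $\mathcal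 A_i(S_i)$. *Delayed compute (optional).* Then, $\ell$ times: receive the number $i$ of a slice that has not yet been called in this phase and an $(\varepsilon,\delta)$-DP algorithm $\mathcal A'$, and publish $\mathcal A'(S_i)$. (If $\ell=0$ the phase is omitted; if $\ell=\tau$ every slice is called exactly once.) Everything that is received may be chosen adaptively, as a (measurable) function of all results published before. The output of the algorithm is the sequence of all published results. **Theorem.** There is a universal constant $C>0$ such that for all $X$, $\varepsilon,\delta,\tau,\ell$ as above, every range of the published results, every adaptive strategy for the choices and every $\hat\delta>0$: 1. the algorithm is $\bigl(C\,\varepsilon\log(1/\hat\delta),\ \hat\delta+(1+e^{\varepsilon})(\tau+\ell)\,\delta\bigr)$-DP; 2. if $\tau\ge 8$, or if $\ell=0$ and $\varepsilon\le\ln 2$, then the algorithm is $\bigl(C\,\varepsilon\log(1/\hat\delta),\ \hat\delta+2\tau\delta\bigr)$-DP. -/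

import Mathlib

open MeasureTheory

universe u v w

namespace ReorderSliceCompute

/-- Two multisets are adjacent if one of them is the other with a single element inserted. -/
def Adjacent {X : Type u} (D D' : Multiset X) : Prop :=
  ∃ x : X, D' = x ::ₘ D ∨ D = x ::ₘ D'

/-- `ListInsert L L'`: the list `L'` is `L` with a single element inserted at some position. -/
def ListInsert {X : Type u} (L L' : List X) : Prop :=
  ∃ (l₁ l₂ : List X) (x : X), L = l₁ ++ l₂ ∧ L' = l₁ ++ x :: l₂

/-- Two lists are adjacent if one of them is the other with a single element inserted. -/
def ListAdjacent {X : Type u} (L L' : List X) : Prop :=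
  ListInsert L L' ∨ ListInsert L' L

/-- A deterministic map from multisets to lists is adjacency preserving if it sends adjacent
multisets to equal or adjacent lists. -/
def AdjacencyPreserving {X : Type u} (E : Multiset X → List X) : Prop :=
  ∀ D D' : Multiset X, Adjacent D D' → E D = E D' ∨ ListAdjacent (E D) (E D')

/-- A randomized algorithm on datasets, given by its output law on every dataset, is
`(ε, δ)`-differentially private. -/
structure IsDP {X : Type u} {Z : Type w} [MeasurableSpace Z] (M : Multiset X → Measure Z)
    (ε δ : ℝ) : Prop where
  isProbabilityMeasure : ∀ D, IsProbabilityMeasure (M D)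
  le : ∀ D D' : Multiset X, Adjacent D D' → ∀ F : Set Z, MeasurableSet F →
    M D F ≤ ENNReal.ofReal (Real.exp ε) * M D' F + ENNReal.ofReal δ

/-- The geometric distribution with parameter `1 - e^{-ε}` on `{0, 1, 2, …}`, for `ε ≥ 0`
(then the projection to the unit interval does nothing). -/
noncomputable def geomNoise (ε : ℝ) : Measure ℕ :=
  ProbabilityTheory.geometricMeasure
    (Set.projIcc (0 : ℝ) 1 zero_le_one (1 - Real.exp (-ε)))

theorem geomNoise_singleton {ε : ℝ} (hε : 0 < ε) (k : ℕ) :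
    geomNoise ε {k} = ENNReal.ofReal (Real.exp (-ε) ^ k * (1 - Real.exp (-ε))) := by
  have h1 : Real.exp (-ε) < 1 := by
    rw [Real.exp_lt_one_iff]
    linarith
  have h0 : 0 < Real.exp (-ε) := Real.exp_pos _
  have hmem : 1 - Real.exp (-ε) ∈ Set.Icc (0 : ℝ) 1 := ⟨by linarith, by linarith⟩
  unfold geomNoise
  rw [Set.projIcc_of_mem zero_le_one hmem,
    ProbabilityTheory.geometricMeasure_singleton]
  · simp
  · intro h
    have h2 : 1 - Real.exp (-ε) = 0 := congrArg Subtype.val h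
    linarith

/-- The adaptive choices made in the delayed-compute phase when `k` delayed computations remain:
a decision tree. At a node the number `i` of a slice and an algorithm `A` are chosen; after the
result `r` is published the choices continue with `next r`. -/
inductive DelayedAnalyst (X : Type u) (Y : Type v) [MeasurableSpace Y] : ℕ → Type (max u v)
  | done : DelayedAnalyst X Y 0
  | query {k : ℕ} (i : ℕ) (A : Multiset X → Measure Y) (next : Y → DelayedAnalyst X Y k) :
      DelayedAnalyst X Y (k + 1)

/-- The adaptive choices made when `k` rounds of the slice-and-compute phase remain, to be followed
by a delayed-compute phase with `ℓ` computations: a decision tree. At a node the tuple `(m, A, E)`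
is chosen; after the result `r` is published the choices continue with `next r`. -/
inductive Analyst (X : Type u) (Y : Type v) [MeasurableSpace Y] (ℓ : ℕ) : ℕ → Type (max u v)
  | delayed (s : DelayedAnalyst X Y ℓ) : Analyst X Y ℓ 0
  | query {k : ℕ} (m : ℕ) (A : Multiset X → Measure Y) (E : Multiset X → List X)
      (next : Y → Analyst X Y ℓ k) : Analyst X Y ℓ (k + 1)

/-- Law of the results published in the delayed-compute phase, where `slices` is the list of
all stored slices (numbered from `0`). -/
noncomputable def DelayedAnalyst.run {X : Type u} {Y : Type v} [MeasurableSpace Y]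
    (slices : List (Multiset X)) : {k : ℕ} → DelayedAnalyst X Y k → Measure (Fin k → Y)
  | _, .done => Measure.dirac Fin.elim0
  | _, .query i A next =>
      (A (slices.getD i 0)).bind fun r =>
        (DelayedAnalyst.run slices (next r)).map (Fin.cons (α := fun _ => Y) r)

/-- Law of the results published by the algorithm from the moment where `D` is the remaining
dataset, `slices` is the list of the slices cut so far, and the remaining choices are given by the
analyst. In each round the geometric noise `g` is drawn, the first `m + g` elements of `E D` are
the slice, on which `A` is run, and the other elements of `E D` form the new dataset. -/
noncomputable def Analyst.run {X : Type u} {Y : Type v} [MeasurableSpace Y] {ℓ : ℕ} (ε : ℝ) :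
    {k : ℕ} → Analyst X Y ℓ k → Multiset X → List (Multiset X) → Measure (Fin (ℓ + k) → Y)
  | _, .delayed s, _, slices => s.run slices
  | _, .query m A E next, D, slices =>
      (geomNoise ε).bind fun g =>
        (A ((E D).take (m + g) : Multiset X)).bind fun r =>
          (Analyst.run ε (next r) ((E D).drop (m + g) : Multiset X)
            (slices ++ [((E D).take (m + g) : Multiset X)])).map
              (Fin.cons (α := fun _ => Y) r)

/-- The choices in the delayed-compute phase are legal, where `I` is the set of the slice numbers
that have not been called yet: every algorithm is `(ε, δ)`-DP and every slice is called at most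
once. The measurability requirement says that the law of the continuation depends
measurably on the published result, so that the law of the whole interaction is well defined. -/
def DelayedAnalyst.Valid {X : Type u} {Y : Type v} [MeasurableSpace Y] (ε δ : ℝ) :
    {k : ℕ} → DelayedAnalyst X Y k → Finset ℕ → Prop
  | _, .done, _ => True
  | _, .query i A next, I =>
      i ∈ I ∧ IsDP A ε δ ∧
        (∀ slices : List (Multiset X), Measurable fun r => (next r).run slices) ∧
        ∀ r, DelayedAnalyst.Valid ε δ (next r) (I.erase i)

/-- The choices in an execution with `τ` slices in total are legal: every algorithm is
`(ε, δ)`-DP, every map is adjacency preserving, and the delayed-compute phase is legal. The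
measurability requirement is as before. -/
def Analyst.Valid {X : Type u} {Y : Type v} [MeasurableSpace Y] {ℓ : ℕ} (τ : ℕ) (ε δ : ℝ) :
    {k : ℕ} → Analyst X Y ℓ k → Prop
  | _, .delayed s => s.Valid ε δ (Finset.range τ)
  | _, .query _ A E next =>
      IsDP A ε δ ∧ AdjacencyPreserving E ∧
        (∀ (D : Multiset X) (slices : List (Multiset X)),
          Measurable fun r => (next r).run ε D slices) ∧
        ∀ r, Analyst.Valid τ ε δ (next r)

/-- The algorithm Reorder-Slice-Compute on the input dataset `D`, with `τ` rounds of
slice-and-compute followed by `ℓ` delayed computations, all chosen by `analyst`: the law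
of the sequence of all published results. -/
noncomputable def reorderSliceCompute {X : Type u} {Y : Type v} [MeasurableSpace Y] {τ ℓ : ℕ}
    (ε : ℝ) (analyst : Analyst X Y ℓ τ) (D : Multiset X) : Measure (Fin (ℓ + τ) → Y) :=
  analyst.run ε D []

end ReorderSliceCompute

/-! Compare two executions on adjacent datasets in a round whose reordered lists differ by one
inserted element. While the cut stays before that element, the slices coincide, the remainders stay
adjacent, and the round costs nothing. Since the geometric law is memoryless, the case of a cut
beyond it can be treated with the noise restarted at 0.

If the execution to be bounded has the shorter list, noise `g` is matched with `g + 1` at the price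
of a factor `e^ε`: the slices are adjacent, the remainders coincide, and afterwards only a delayed
call can reveal a difference. If it has the longer list, `g` should be matched with `g - 1`, but
noise 0 has no partner. Some mass, including all mass at 0, is instead matched with equal noise.
Such a round fails: the slices differ by up to two elements and the remainders may still be
adjacent. A failure has weight at most 2/3 and costs at most `6ε`, so an allowance of `j` failures
gives the losses `6jε` and `(2/3)^j`; then `j` is taken of order `log (1 / δhat)`. This is
`Analyst.approxLE_run`, resting on `tsum_geomWeight_mul_le_of_split`.

The multiples of `δ` are averaged over success and failure, which gives the recursion `IsRoundLoss`.
Delayed calls are charged either when they are made (`u = 0`) or when the slice is cut (`u = 1`). As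
later rounds matter only after failures, the recursion even has a constant solution, 16, which is at
most `2τ` for `τ ≥ 8`. -/

namespace ReorderSliceCompute

/-! ### Calculus of one-sided approximate comparison -/

/-- The one-sided `(s, d)`-indistinguishability of two measures. -/
def ApproxLE {Z : Type*} [MeasurableSpace Z] (s d : ℝ) (P Q : Measure Z) : Prop :=
  ∀ F : Set Z, MeasurableSet F →
    P F ≤ ENNReal.ofReal (Real.exp s) * Q F + ENNReal.ofReal d

namespace ApproxLE

variable {Z W : Type*} [MeasurableSpace Z] [MeasurableSpace W] {s s' d d' t c : ℝ}
  {P Q R : Measure Z}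

theorem mono (h : ApproxLE s d P Q) (hs : s ≤ s') (hd : d ≤ d') : ApproxLE s' d' P Q := by
  intro F hF
  refine (h F hF).trans ?_
  gcongr

theorem refl (P : Measure Z) : ApproxLE 0 0 P P := by
  intro F _
  simp

theorem of_one_le [IsProbabilityMeasure P] (hd : 1 ≤ d) : ApproxLE s d P Q := by
  intro F _
  calc P F ≤ 1 := prob_le_one
    _ ≤ ENNReal.ofReal d := by simpa using hd
    _ ≤ _ := le_add_self

theorem trans (h : ApproxLE s d P Q) (h' : ApproxLE t c Q R) (hd : 0 ≤ d) (hc : 0 ≤ c) :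
    ApproxLE (s + t) (d + Real.exp s * c) P R := by
  intro F hF
  calc P F ≤ ENNReal.ofReal (Real.exp s) * Q F + ENNReal.ofReal d := h F hF
    _ ≤ ENNReal.ofReal (Real.exp s) *
        (ENNReal.ofReal (Real.exp t) * R F + ENNReal.ofReal c) + ENNReal.ofReal d := by
      gcongr; exact h' F hF
    _ = _ := by
      rw [Real.exp_add, ENNReal.ofReal_mul (Real.exp_pos s).le,
        ENNReal.ofReal_add hd (by positivity), ENNReal.ofReal_mul (Real.exp_pos s).le]
      ring

theorem map (h : ApproxLE s d P Q) {f : Z → W} (hf : Measurable f) :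
    ApproxLE s d (P.map f) (Q.map f) := by
  intro F hF
  rw [Measure.map_apply hf hF, Measure.map_apply hf hF]
  exact h _ (hf hF)

/-- Layer-cake formula: the comparison applies to each superlevel set, and since `f ≤ 1` the levels
have total length 1, so `d` is paid once. -/
theorem lintegral_le (h : ApproxLE s d P Q) {f : Z → ENNReal} (hf : Measurable f)
    (hf1 : ∀ z, f z ≤ 1) :
    ∫⁻ z, f z ∂P ≤ ENNReal.ofReal (Real.exp s) * ∫⁻ z, f z ∂Q + ENNReal.ofReal d := by
  have hfin : ∀ z, f z ≠ ⊤ := fun z => ne_top_of_le_ne_top ENNReal.one_ne_top (hf1 z)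
  have key : ∀ μ : Measure Z,
      ∫⁻ z, f z ∂μ = ∫⁻ t in Set.Ioc (0 : ℝ) 1, μ {z | t < (f z).toReal} := by
    intro μ
    have h1 : ∫⁻ z, f z ∂μ = ∫⁻ z, ENNReal.ofReal (f z).toReal ∂μ := by
      simp_rw [ENNReal.ofReal_toReal (hfin _)]
    rw [h1, lintegral_eq_lintegral_meas_lt μ
      (Filter.Eventually.of_forall fun _ => ENNReal.toReal_nonneg)
      hf.ennreal_toReal.aemeasurable, ← Set.Ioc_union_Ioi_eq_Ioi zero_le_one,
      lintegral_union measurableSet_Ioi (Set.Ioc_disjoint_Ioi le_rfl)]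
    have h2 : ∫⁻ t in Set.Ioi (1 : ℝ), μ {z | t < (f z).toReal} = 0 := by
      rw [setLIntegral_congr_fun (g := fun _ => 0) measurableSet_Ioi]
      · simp
      · intro t ht
        have : {z | t < (f z).toReal} = ∅ := by
          ext z
          have h3 : (f z).toReal ≤ 1 :=
            ENNReal.toReal_le_of_le_ofReal zero_le_one (by simpa using hf1 z)
          simp only [Set.mem_ofPred_eq, Set.mem_empty_iff_false, iff_false, not_lt]
          exact h3.trans (le_of_lt ht)
        simp [this]
    rw [h2, add_zero]
  rw [key P, key Q, ← lintegral_const_mul' _ _ ENNReal.ofReal_ne_top]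
  calc ∫⁻ t in Set.Ioc (0 : ℝ) 1, P {z | t < (f z).toReal}
      ≤ ∫⁻ t in Set.Ioc (0 : ℝ) 1, (ENNReal.ofReal (Real.exp s) * Q {z | t < (f z).toReal}
          + ENNReal.ofReal d) := by
        refine lintegral_mono fun t => h _ ?_
        exact measurableSet_lt measurable_const hf.ennreal_toReal
    _ = _ := by
        rw [lintegral_add_right _ measurable_const]
        simp

theorem bind (h : ApproxLE s d P Q) {κ κ' : Z → Measure W} (hκ : Measurable κ)
    (hκ' : Measurable κ') [IsProbabilityMeasure P] (hp : ∀ z, IsProbabilityMeasure (κ z))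
    (hκκ' : ∀ z, ApproxLE t c (κ z) (κ' z)) (hd : 0 ≤ d) (hc : 0 ≤ c) :
    ApproxLE (s + t) (d + c) (P.bind κ) (Q.bind κ') := by
  intro F hF
  rw [Measure.bind_apply hF hκ.aemeasurable, Measure.bind_apply hF hκ'.aemeasurable]
  have hm : Measurable fun z => κ' z F := (Measure.measurable_coe hF).comp hκ'
  set b := ENNReal.ofReal (Real.exp t)
  -- Capping at 1 makes `lintegral_le` applicable, and splitting off `c` beforehand yields `d + c`
  -- without a factor `e^s` on `c`.
  calc ∫⁻ z, κ z F ∂P ≤ ∫⁻ z, (min (b * κ' z F) 1 + ENNReal.ofReal c) ∂P := by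
        refine lintegral_mono fun z => ?_
        rw [min_add]
        exact le_min (hκκ' z F hF) ((prob_le_one (μ := κ z)).trans le_self_add)
    _ = ∫⁻ z, min (b * κ' z F) 1 ∂P + ENNReal.ofReal c := by
        rw [lintegral_add_right _ measurable_const]
        simp
    _ ≤ (ENNReal.ofReal (Real.exp s) * ∫⁻ z, min (b * κ' z F) 1 ∂Q + ENNReal.ofReal d)
          + ENNReal.ofReal c := by
        gcongr
        exact h.lintegral_le ((hm.const_mul b).min measurable_const) fun z => min_le_right _ _
    _ ≤ (ENNReal.ofReal (Real.exp s) * (b * ∫⁻ z, κ' z F ∂Q) + ENNReal.ofReal d)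
          + ENNReal.ofReal c := by
        rw [← lintegral_const_mul b hm]
        gcongr with z
        exact min_le_left _ _
    _ = _ := by
        rw [Real.exp_add, ENNReal.ofReal_mul (Real.exp_pos s).le, ENNReal.ofReal_add hd hc]
        ring

end ApproxLE

/-! ### Laws of sequences of results -/

theorem measurable_cons {Y : Type*} [MeasurableSpace Y] {n : ℕ} (r : Y) :
    Measurable (Fin.cons (n := n) (α := fun _ => Y) r) := by
  rw [measurable_pi_iff]
  intro i
  refine Fin.cases ?_ (fun i => ?_) i
  · simp
  · simpa using measurable_pi_apply i

/-- The family `κ` is a Markov kernel, so the measures of the sections of a measurable set depend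
measurably on `r`. -/
theorem measurable_map_cons {Y : Type*} [MeasurableSpace Y] {n : ℕ}
    {κ : Y → Measure (Fin n → Y)} (hκ : Measurable κ) (hp : ∀ r, IsProbabilityMeasure (κ r)) :
    Measurable fun r => (κ r).map (Fin.cons (α := fun _ => Y) r) := by
  have hc : Measurable fun q : Y × (Fin n → Y) => (Fin.cons (α := fun _ => Y) q.1 q.2) := by
    rw [measurable_pi_iff]
    intro i
    refine Fin.cases ?_ (fun i => ?_) i
    · simpa using measurable_fst
    · simp only [Fin.cons_succ]
      fun_prop
  refine Measure.measurable_of_measurable_coe _ fun F hF => ?_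
  let κ' : ProbabilityTheory.Kernel Y (Fin n → Y) := ⟨κ, hκ⟩
  have : ProbabilityTheory.IsMarkovKernel κ' := ⟨hp⟩
  have h := ProbabilityTheory.Kernel.measurable_kernel_prodMk_left (κ := κ') (hc hF)
  convert h using 2 with r
  rw [Measure.map_apply (measurable_cons r) hF]
  rfl

/-- The law of the results when a first computation has law `P` and `κ r` is the law of the
results published after its result `r`. -/
noncomputable def consBind {Y : Type*} [MeasurableSpace Y] {n : ℕ} (P : Measure Y)
    (κ : Y → Measure (Fin n → Y)) : Measure (Fin (n + 1) → Y) :=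
  P.bind fun r => (κ r).map (Fin.cons (α := fun _ => Y) r)

theorem isProbabilityMeasure_consBind {Y : Type*} [MeasurableSpace Y] {n : ℕ} {P : Measure Y}
    {κ : Y → Measure (Fin n → Y)} [IsProbabilityMeasure P] (hκ : Measurable κ)
    (hp : ∀ r, IsProbabilityMeasure (κ r)) : IsProbabilityMeasure (consBind P κ) :=
  isProbabilityMeasure_bind (measurable_map_cons hκ hp).aemeasurable
    (Filter.Eventually.of_forall fun r =>
      Measure.isProbabilityMeasure_map (measurable_cons r).aemeasurable)

theorem ApproxLE.consBind {Y : Type*} [MeasurableSpace Y] {n : ℕ} {P Q : Measure Y}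
    {κ κ' : Y → Measure (Fin n → Y)} {s d t c : ℝ} (h : ApproxLE s d P Q)
    (hκ : Measurable κ) (hκ' : Measurable κ') [IsProbabilityMeasure P]
    (hp : ∀ r, IsProbabilityMeasure (κ r)) (hp' : ∀ r, IsProbabilityMeasure (κ' r))
    (hκκ' : ∀ r, ApproxLE t c (κ r) (κ' r)) (hd : 0 ≤ d) (hc : 0 ≤ c) :
    ApproxLE (s + t) (d + c) (consBind P κ) (consBind Q κ') :=
  h.bind (measurable_map_cons hκ hp) (measurable_map_cons hκ' hp')
    (fun r => Measure.isProbabilityMeasure_map (measurable_cons r).aemeasurable)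
    (fun r => (hκκ' r).map (measurable_cons r)) hd hc

/-! ### Group privacy -/

/-- The two multisets differ by at most `n` insertions and deletions. -/
def Near {X : Type u} : ℕ → Multiset X → Multiset X → Prop
  | 0, S, S' => S = S'
  | n + 1, S, S' => ∃ T, (S = T ∨ Adjacent S T) ∧ Near n T S'

theorem Near.rfl {X : Type u} {n : ℕ} {S : Multiset X} : Near n S S := by
  induction n with
  | zero => exact Eq.refl S
  | succ n ih => exact ⟨S, Or.inl (Eq.refl S), ih⟩

theorem near_one {X : Type u} {S S' : Multiset X} : Near 1 S S' ↔ S = S' ∨ Adjacent S S' := by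
  simp [Near]

theorem Adjacent.symm {X : Type u} {S S' : Multiset X} (h : Adjacent S S') : Adjacent S' S := by
  obtain ⟨x, h⟩ := h
  exact ⟨x, h.symm⟩

theorem near_two {X : Type u} {S S' T : Multiset X} (h : Near 1 S T) (h' : Near 1 T S') :
    Near 2 S S' :=
  ⟨T, near_one.1 h, h'⟩

/-- The additive loss in group privacy for groups of size `n`, as a multiple of `δ`. -/
noncomputable def groupLoss (ε : ℝ) (n : ℕ) : ℝ := ∑ i ∈ Finset.range n, Real.exp ε ^ i

theorem groupLoss_nonneg (ε : ℝ) (n : ℕ) : 0 ≤ groupLoss ε n :=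
  Finset.sum_nonneg fun _ _ => by positivity

theorem groupLoss_zero (ε : ℝ) : groupLoss ε 0 = 0 := by simp [groupLoss]

theorem groupLoss_one (ε : ℝ) : groupLoss ε 1 = 1 := by simp [groupLoss]

theorem groupLoss_two (ε : ℝ) : groupLoss ε 2 = 1 + Real.exp ε := by
  simp [groupLoss, Finset.sum_range_succ]

theorem groupLoss_le_of_le_two {ε : ℝ} {n : ℕ} (hn : n ≤ 2) : groupLoss ε n ≤ 1 + Real.exp ε := by
  rw [← groupLoss_two]
  exact Finset.sum_le_sum_of_subset_of_nonneg (Finset.range_mono hn) fun _ _ _ => by positivity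

/-- Chaining `n` steps multiplies the additive loss of each step by the factors `e^ε` of the steps
before it, whence the geometric sum. -/
theorem IsDP.approxLE {X : Type u} {Z : Type w} [MeasurableSpace Z] {M : Multiset X → Measure Z}
    {ε δ : ℝ} (h : IsDP M ε δ) (hε : 0 ≤ ε) (hδ : 0 ≤ δ) {n : ℕ} {S S' : Multiset X}
    (hS : Near n S S') : ApproxLE (ε * n) (groupLoss ε n * δ) (M S) (M S') := by
  induction n generalizing S with
  | zero =>
    obtain rfl : S = S' := hS
    simpa [groupLoss] using ApproxLE.refl (M S)
  | succ n ih =>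
    obtain ⟨T, hST, hT⟩ := hS
    have h1 : ApproxLE ε δ (M S) (M T) := by
      rcases hST with rfl | hST
      · exact (ApproxLE.refl _).mono hε hδ
      · exact h.le S T hST
    refine (h1.trans (ih hT) hδ (mul_nonneg (groupLoss_nonneg _ _) hδ)).mono
      (by push_cast; linarith) (le_of_eq ?_)
    rw [groupLoss, groupLoss, Finset.sum_range_succ',
      Finset.sum_congr (Eq.refl _) fun i _ => pow_succ' (Real.exp ε) i,
      ← Finset.mul_sum]
    ring

/-! ### Comparison of averages over geometric noise -/

/-- The geometric weights `z ^ g * (1 - z)`. -/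
noncomputable def geomWeight (z : ℝ) (g : ℕ) : ENNReal := ENNReal.ofReal (z ^ g * (1 - z))

section GeomWeight

variable {z : ℝ}

theorem geomWeight_succ (hz : 0 ≤ z) (g : ℕ) :
    geomWeight z (g + 1) = ENNReal.ofReal z * geomWeight z g := by
  rw [geomWeight, geomWeight, ← ENNReal.ofReal_mul hz]
  ring_nf

theorem tsum_ofReal_geom {z a : ℝ} (hz : 0 ≤ z) (hz1 : z < 1) (ha : 0 ≤ a) :
    ∑' g : ℕ, ENNReal.ofReal (z ^ g * a) = ENNReal.ofReal (a / (1 - z)) := by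
  rw [← ENNReal.ofReal_tsum_of_nonneg (fun g => by positivity)
    ((summable_geometric_of_lt_one hz hz1).mul_right _), tsum_mul_right,
    tsum_geometric_of_lt_one hz hz1]
  congr 1
  ring

theorem tsum_geomWeight (hz : 0 ≤ z) (hz1 : z < 1) : ∑' g, geomWeight z g = 1 := by
  unfold geomWeight
  rw [tsum_ofReal_geom hz hz1 (by linarith), div_self (by linarith)]
  simp

theorem tsum_geomWeight_mul_eq (hz : 0 ≤ z) (G : ℕ → ENNReal) :
    ∑' g, geomWeight z g * G g =
      ENNReal.ofReal (1 - z) * G 0 + ENNReal.ofReal z * ∑' g, geomWeight z g * G (g + 1) := by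
  rw [tsum_eq_zero_add' ENNReal.summable]
  simp_rw [geomWeight_succ hz, mul_assoc, ENNReal.tsum_mul_left]
  simp [geomWeight]

theorem tsum_geomWeight_mul_le (hz : 0 ≤ z) (hz1 : z < 1) {G H : ℕ → ENNReal}
    {B R : ENNReal} (h : ∀ g, G g ≤ B * H g + R) :
    ∑' g, geomWeight z g * G g ≤ B * ∑' g, geomWeight z g * H g + R := by
  calc ∑' g, geomWeight z g * G g ≤ ∑' g, geomWeight z g * (B * H g + R) := by
        gcongr with g; exact h g
    _ = _ := by
        simp_rw [mul_add, ENNReal.tsum_add, ENNReal.tsum_mul_right, tsum_geomWeight hz hz1,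
          one_mul, mul_left_comm _ B, ENNReal.tsum_mul_left]

/-- By memorylessness, a comparison of two averages over the geometric distribution can be
started at any value of the noise. -/
theorem tsum_geomWeight_mul_le_of_tail (hz : 0 ≤ z) (hz1 : z < 1) {G H : ℕ → ENNReal}
    {B R : ENNReal} (t : ℕ) (hhead : ∀ g < t, G g ≤ B * H g + R)
    (htail : ∑' g, geomWeight z g * G (g + t) ≤ B * ∑' g, geomWeight z g * H (g + t) + R) :
    ∑' g, geomWeight z g * G g ≤ B * ∑' g, geomWeight z g * H g + R := by
  induction t generalizing G H with
  | zero => simpa using htail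
  | succ t ih =>
    have h1 := ih (G := fun g => G (g + 1)) (H := fun g => H (g + 1))
      (fun g hg => hhead (g + 1) (by omega))
      (by simpa only [add_assoc, add_comm t 1] using htail)
    have h0 := hhead 0 (by omega)
    rw [tsum_geomWeight_mul_eq hz G, tsum_geomWeight_mul_eq hz H]
    have hsum : ENNReal.ofReal (1 - z) + ENNReal.ofReal z = 1 := by
      rw [← ENNReal.ofReal_add (by linarith) hz]
      simp
    calc _ ≤ ENNReal.ofReal (1 - z) * (B * H 0 + R) +
          ENNReal.ofReal z * (B * ∑' g, geomWeight z g * H (g + 1) + R) := by gcongr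
      _ = B * (ENNReal.ofReal (1 - z) * H 0 + ENNReal.ofReal z * ∑' g, geomWeight z g * H (g + 1))
          + (ENNReal.ofReal (1 - z) + ENNReal.ofReal z) * R := by ring
      _ = _ := by rw [hsum, one_mul]

/-- Comparison of the noise `g` with the noise `g + 1`. -/
theorem tsum_geomWeight_mul_le_of_shift (hz : 0 < z) (hz1 : z < 1) {G H : ℕ → ENNReal}
    {b B R : ENNReal} (hB : ENNReal.ofReal z⁻¹ * b ≤ B) (h : ∀ g, G g ≤ b * H (g + 1) + R) :
    ∑' g, geomWeight z g * G g ≤ B * ∑' g, geomWeight z g * H g + R := by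
  have hzz : ENNReal.ofReal z⁻¹ * ENNReal.ofReal z = 1 := by
    rw [← ENNReal.ofReal_mul (by positivity), inv_mul_cancel₀ hz.ne']
    simp
  calc ∑' g, geomWeight z g * G g ≤ b * ∑' g, geomWeight z g * H (g + 1) + R :=
        tsum_geomWeight_mul_le hz.le hz1 h
    _ = ENNReal.ofReal z⁻¹ * b * (ENNReal.ofReal z * ∑' g, geomWeight z g * H (g + 1)) + R := by
        rw [mul_assoc, mul_left_comm b, ← mul_assoc, hzz, one_mul]
    _ ≤ B * ∑' g, geomWeight z g * H g + R := by
        gcongr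
        -- The term `H 0` is not reached by the shift and is dropped.
        rw [tsum_geomWeight_mul_eq hz.le H]
        exact le_add_self

/-- Comparison of the noise `g` partly with the noise `g` and partly with the noise `g - 1`. The
fraction `y ^ g` of the mass at `g` is compared with `g`, at the cost `r`, and the
remaining mass is compared with `g - 1`, at the cost `r'`. -/
theorem tsum_geomWeight_mul_le_of_split (hz : 0 ≤ z) (hz1 : z < 1) {y : ℝ} (hy : 0 ≤ y)
    (hy1 : y ≤ 1) {G H : ℕ → ENNReal} {K r r' R : ℝ} {b B : ENNReal} (hK : 2 - y ≤ K)
    (hB : ENNReal.ofReal K * b ≤ B) (hr : 0 ≤ r) (hr' : 0 ≤ r')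
    (hR : (1 - z) / (1 - z * y) * r + (1 - (1 - z) / (1 - z * y)) * r' ≤ R)
    (h : ∀ g, G g ≤ b * H g + ENNReal.ofReal r)
    (h' : ∀ g, G (g + 1) ≤ b * H g + ENNReal.ofReal r') :
    ∑' g, geomWeight z g * G g ≤ B * ∑' g, geomWeight z g * H g + ENNReal.ofReal R := by
  have hzy : z * y < 1 := by nlinarith
  have hyp : ∀ g : ℕ, y ^ g ≤ 1 := fun g => pow_le_one₀ hy hy1
  set w : ℕ → ENNReal := fun g => ENNReal.ofReal (z ^ g * (1 - z) * y ^ g)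
  set w' : ℕ → ENNReal := fun g => ENNReal.ofReal (z ^ g * (1 - z) * (1 - y ^ g))
  have hz1' : 0 ≤ 1 - z := by linarith
  have hww : ∀ g, geomWeight z g = w g + w' g := by
    intro g
    have := hyp g
    rw [geomWeight, ← ENNReal.ofReal_add (by positivity)
      (mul_nonneg (by positivity) (by linarith))]
    ring_nf
  have hw : ∑' g, w g = ENNReal.ofReal ((1 - z) / (1 - z * y)) := by
    rw [← tsum_ofReal_geom (by positivity) hzy hz1']
    congr 1 with g
    simp only [w]
    congr 1
    ring
  -- As `y ^ 0 = 1`, all mass at 0 is matched with 0, so the rest can be moved down by one.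
  have hw0 : w' 0 = 0 := by simp [w']
  have hβ0 : 0 ≤ (1 - z) / (1 - z * y) := div_nonneg hz1' (by linarith)
  have hβ1 : (1 - z) / (1 - z * y) ≤ 1 := by
    rw [div_le_one (by linarith)]
    nlinarith
  have hw' : ∑' g, w' g = ENNReal.ofReal (1 - (1 - z) / (1 - z * y)) := by
    have h1 : ∑' g, w g + ∑' g, w' g = 1 := by
      rw [← ENNReal.tsum_add, ← tsum_geomWeight hz hz1]
      simp_rw [hww]
    rw [hw] at h1
    rw [ENNReal.ofReal_sub _ hβ0, ENNReal.ofReal_one, ← h1,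
      ENNReal.add_sub_cancel_left ENNReal.ofReal_ne_top]
  -- The value `g` is used by `g` and by `g + 1`; relative to its weight it receives `y ^ g + z * (1
  -- - y ^ (g + 1))`, at most `1 + y ^ g * (1 - y) ≤ 2 - y`.
  have hcap : ∀ g, w g + w' (g + 1) ≤ ENNReal.ofReal K * geomWeight z g := by
    intro g
    have h1 := hyp g
    have h2 := hyp (g + 1)
    have h0 : 0 ≤ y ^ g := by positivity
    rw [geomWeight, ← ENNReal.ofReal_add (by positivity)
      (mul_nonneg (by positivity) (by linarith)), ← ENNReal.ofReal_mul (by linarith)]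
    apply ENNReal.ofReal_le_ofReal
    have h3 : y ^ g + z * (1 - y ^ (g + 1)) ≤ K := by
      have : z * (1 - y ^ (g + 1)) ≤ 1 - y ^ (g + 1) := by nlinarith
      rw [pow_succ] at this ⊢
      nlinarith
    calc _ = z ^ g * (1 - z) * (y ^ g + z * (1 - y ^ (g + 1))) := by ring
      _ ≤ z ^ g * (1 - z) * K := by gcongr
      _ = _ := by ring
  calc ∑' g, geomWeight z g * G g = ∑' g, w g * G g + ∑' g, w' (g + 1) * G (g + 1) := by
        simp_rw [hww, add_mul, ENNReal.tsum_add]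
        rw [tsum_eq_zero_add' (f := fun g => w' g * G g) ENNReal.summable, hw0]
        simp
    _ ≤ ∑' g, w g * (b * H g + ENNReal.ofReal r)
        + ∑' g, w' (g + 1) * (b * H g + ENNReal.ofReal r') := by
        gcongr with g g
        · exact h g
        · exact h' g
    _ = b * ∑' g, (w g + w' (g + 1)) * H g + ((∑' g, w g) * ENNReal.ofReal r
        + (∑' g, w' (g + 1)) * ENNReal.ofReal r') := by
        simp_rw [mul_add, add_mul, ENNReal.tsum_add, ENNReal.tsum_mul_right, mul_add,
          mul_left_comm _ b, ENNReal.tsum_mul_left]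
        ring
    _ ≤ b * ∑' g, (ENNReal.ofReal K * geomWeight z g) * H g
        + ((∑' g, w g) * ENNReal.ofReal r + (∑' g, w' g) * ENNReal.ofReal r') := by
        have : ∑' g, w' (g + 1) ≤ ∑' g, w' g := by
          rw [tsum_eq_zero_add' (f := w') ENNReal.summable]
          exact le_add_self
        gcongr with g
        exact hcap g
    _ ≤ B * ∑' g, geomWeight z g * H g + ENNReal.ofReal R := by
        rw [hw, hw', ← ENNReal.ofReal_mul hβ0, ← ENNReal.ofReal_mul (by linarith),
          ← ENNReal.ofReal_add (by positivity) (mul_nonneg (by linarith) hr')]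
        simp_rw [mul_assoc, ENNReal.tsum_mul_left]
        rw [← mul_assoc, mul_comm b]
        gcongr

end GeomWeight

/-! ### Prefixes and remainders of adjacent lists -/

section Lists

variable {X : Type u}

theorem near_one_cons (x : X) (S : Multiset X) : Near 1 S (x ::ₘ S) :=
  near_one.2 (Or.inr ⟨x, Or.inl rfl⟩)

theorem Near.symm_one {S S' : Multiset X} (h : Near 1 S S') : Near 1 S' S := by
  rw [near_one] at h ⊢
  exact h.imp Eq.symm Adjacent.symm

theorem near_one_take_succ (L : List X) (n : ℕ) :
    Near 1 (L.take n : Multiset X) (L.take (n + 1) : Multiset X) := by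
  rcases lt_or_ge n L.length with h | h
  · rw [← List.take_append_getElem h, ← Multiset.coe_add, Multiset.coe_singleton, add_comm,
      Multiset.singleton_add]
    exact near_one_cons _ _
  · rw [List.take_of_length_le h, List.take_of_length_le (by omega)]
    exact Near.rfl

theorem near_one_drop_succ (L : List X) (n : ℕ) :
    Near 1 (L.drop (n + 1) : Multiset X) (L.drop n : Multiset X) := by
  rcases lt_or_ge n L.length with h | h
  · rw [List.drop_eq_getElem_cons h, ← Multiset.cons_coe]
    exact near_one_cons _ _
  · rw [List.drop_of_length_le h, List.drop_of_length_le (by omega)]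
    exact Near.rfl

/-- Slices up to the insertion point coincide, and the remaining elements are adjacent. Slices
beyond the insertion point that differ in size by one are adjacent, and the remaining elements
coincide. -/
theorem ListInsert.exists_index {L L' : List X} (h : ListInsert L L') :
    ∃ p : ℕ, (∀ n ≤ p, L.take n = L'.take n ∧
        Near 1 (L.drop n : Multiset X) (L'.drop n : Multiset X)) ∧
      ∀ n, p ≤ n → Near 1 (L.take n : Multiset X) (L'.take (n + 1) : Multiset X) ∧
        L.drop n = L'.drop (n + 1) := by
  obtain ⟨l₁, l₂, x, rfl, rfl⟩ := h
  refine ⟨l₁.length, fun n hn => ⟨?_, ?_⟩, fun n hn => ?_⟩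
  · rw [List.take_append_of_le_length hn, List.take_append_of_le_length hn]
  · rw [List.drop_append_of_le_length hn, List.drop_append_of_le_length hn, ← Multiset.coe_add,
      ← Multiset.coe_add, ← Multiset.cons_coe, Multiset.add_cons]
    exact near_one_cons _ _
  · obtain ⟨k, rfl⟩ := Nat.exists_eq_add_of_le hn
    constructor
    · rw [add_assoc, List.take_length_add_append, List.take_length_add_append,
        List.take_succ_cons, ← Multiset.coe_add,
        ← Multiset.coe_add, ← Multiset.cons_coe, Multiset.add_cons]
      exact near_one_cons _ _
    · rw [add_assoc, List.drop_length_add_append, List.drop_length_add_append, List.drop_succ_cons]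

/-- Slices of equal size differ by at most two elements, and the remaining elements are equal or
adjacent. -/
theorem ListInsert.near {L L' : List X} (h : ListInsert L L') (n : ℕ) :
    Near 2 (L'.take n : Multiset X) (L.take n : Multiset X) ∧
      Near 1 (L'.drop n : Multiset X) (L.drop n : Multiset X) := by
  obtain ⟨p, h1, h2⟩ := h.exists_index
  rcases le_or_gt n p with hn | hn
  · rw [(h1 n hn).1]
    exact ⟨Near.rfl, (h1 n hn).2.symm_one⟩
  -- Past the insertion point the comparison passes through the prefix of `L` that is shorter by
  -- one.
  · obtain ⟨n, rfl⟩ : ∃ k, n = k + 1 := ⟨n - 1, by omega⟩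
    obtain ⟨h3, h4⟩ := h2 n (by omega)
    rw [← h4]
    exact ⟨near_two h3.symm_one (near_one_take_succ L n), (near_one_drop_succ L n).symm_one⟩

/-- The slices stored in two executions differ by at most `d i` elements at position `i`. -/
def SlicesNear (d : ℕ → ℕ) (sl sl' : List (Multiset X)) : Prop :=
  sl.length = sl'.length ∧ ∀ i, Near (d i) (sl.getD i 0) (sl'.getD i 0)

theorem SlicesNear.append {d : ℕ → ℕ} {sl sl' : List (Multiset X)} (h : SlicesNear d sl sl')
    {v : ℕ} {S S' : Multiset X} (hS : Near v S S') :
    SlicesNear (Function.update d sl.length v) (sl ++ [S]) (sl' ++ [S']) := by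
  refine ⟨by simp [h.1], fun i => ?_⟩
  rcases lt_trichotomy i sl.length with hi | rfl | hi
  · rw [List.getD_append _ _ _ _ hi, List.getD_append _ _ _ _ (h.1 ▸ hi),
      Function.update_of_ne hi.ne]
    exact h.2 i
  · rw [Function.update_self, List.getD_append_right _ _ _ _ le_rfl,
      List.getD_append_right _ _ _ _ h.1.ge, h.1]
    simpa using hS
  · rw [List.getD_eq_default _ _ (by simp; omega),
      List.getD_eq_default _ _ (by simp [← h.1]; omega)]
    exact Near.rfl

theorem SlicesNear.append_same {d : ℕ → ℕ} {sl sl' : List (Multiset X)} (h : SlicesNear d sl sl')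
    (S : Multiset X) : SlicesNear d (sl ++ [S]) (sl' ++ [S]) := by
  simpa using h.append (Near.rfl (n := d sl.length) (S := S))

/-- Only an inequality: the old value at `n` is discarded, and `n` may lie outside `s`. -/
theorem sum_update_le {s : Finset ℕ} (d : ℕ → ℕ) (n v : ℕ) {f : ℕ → ℝ} (hf : ∀ k, 0 ≤ f k) :
    ∑ i ∈ s, f (Function.update d n v i) ≤ ∑ i ∈ s, f (d i) + f v := by
  calc ∑ i ∈ s, f (Function.update d n v i)
      ≤ ∑ i ∈ s, (f (d i) + if i = n then f v else 0) := by
        refine Finset.sum_le_sum fun i _ => ?_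
        by_cases hi : i = n
        · subst hi; simpa using hf _
        · simp [hi]
    _ ≤ ∑ i ∈ s, f (d i) + f v := by
        rw [Finset.sum_add_distrib, Finset.sum_ite_eq']
        split_ifs
        · exact le_rfl
        · simpa using hf v

end Lists

/-! ### Comparison of two executions -/

section Run

variable {X : Type u} {Y : Type v} [MeasurableSpace Y]

instance (ε : ℝ) : IsProbabilityMeasure (geomNoise ε) := by
  unfold geomNoise
  infer_instance

theorem DelayedAnalyst.run_query {k : ℕ} (i : ℕ) (A : Multiset X → Measure Y)
    (next : Y → DelayedAnalyst X Y k) (sl : List (Multiset X)) :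
    (DelayedAnalyst.query i A next).run sl =
      consBind (A (sl.getD i 0)) fun r => (next r).run sl := rfl

theorem Analyst.run_query {ℓ k : ℕ} (ε : ℝ) (m : ℕ) (A : Multiset X → Measure Y)
    (E : Multiset X → List X) (next : Y → Analyst X Y ℓ k) (D : Multiset X)
    (sl : List (Multiset X)) :
    (Analyst.query m A E next).run ε D sl =
      (geomNoise ε).bind fun g => consBind (A ((E D).take (m + g) : Multiset X)) fun r =>
        (next r).run ε ((E D).drop (m + g) : Multiset X)
          (sl ++ [((E D).take (m + g) : Multiset X)]) := rfl

theorem geomNoise_bind_apply {Z : Type*} [MeasurableSpace Z] {ε : ℝ} (hε : 0 < ε)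
    (κ : ℕ → Measure Z) {F : Set Z} (hF : MeasurableSet F) :
    (geomNoise ε).bind κ F = ∑' g, geomWeight (Real.exp (-ε)) g * κ g F := by
  rw [Measure.bind_apply hF (Measurable.of_discrete).aemeasurable, lintegral_countable']
  simp_rw [geomNoise_singleton hε, geomWeight, mul_comm]

theorem DelayedAnalyst.isProbabilityMeasure_run {ε δ : ℝ} {k : ℕ} (s : DelayedAnalyst X Y k)
    {I : Finset ℕ} (hs : s.Valid ε δ I) (sl : List (Multiset X)) :
    IsProbabilityMeasure (s.run sl) := by
  induction s generalizing I with
  | done => exact Measure.dirac.isProbabilityMeasure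
  | query i A next ih =>
    obtain ⟨-, hA, hm, hnext⟩ := hs
    have := hA.isProbabilityMeasure (sl.getD i 0)
    exact isProbabilityMeasure_consBind (hm sl) fun r => ih r (hnext r)

theorem Analyst.isProbabilityMeasure_run {ε δ : ℝ} {τ ℓ k : ℕ} (a : Analyst X Y ℓ k)
    (ha : a.Valid τ ε δ) (D : Multiset X) (sl : List (Multiset X)) :
    IsProbabilityMeasure (a.run ε D sl) := by
  induction a generalizing D sl with
  | delayed s => exact s.isProbabilityMeasure_run ha sl
  | query m A E next ih =>
    obtain ⟨hA, -, hm, hnext⟩ := ha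
    rw [Analyst.run_query]
    refine isProbabilityMeasure_bind (Measurable.of_discrete).aemeasurable
      (Filter.Eventually.of_forall fun g => ?_)
    have := hA.isProbabilityMeasure ((E D).take (m + g) : Multiset X)
    exact isProbabilityMeasure_consBind (hm _ _) fun r => ih r (hnext r) _ _

/-- The additive loss of `k` delayed computations on slices with numbers in `I`, as a multiple
of `δ`: an average, with weights `u` and `1 - u`, of the sum of the losses over
all slices and of `k` times the maximal loss of a slice. -/
noncomputable def delayedLoss (ε u : ℝ) (I : Finset ℕ) (k : ℕ) (d : ℕ → ℕ) : ℝ :=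
  u * ∑ i ∈ I, groupLoss ε (d i) + (1 - u) * (k * (1 + Real.exp ε))

theorem delayedLoss_nonneg {ε u : ℝ} (hu : 0 ≤ u) (hu1 : u ≤ 1) (I : Finset ℕ) (k : ℕ)
    (d : ℕ → ℕ) : 0 ≤ delayedLoss ε u I k d := by
  have : 0 ≤ 1 - u := by linarith
  have := Finset.sum_nonneg fun i (_ : i ∈ I) => groupLoss_nonneg ε (d i)
  unfold delayedLoss
  positivity

theorem delayedLoss_update_le {ε u : ℝ} (hu : 0 ≤ u) (I : Finset ℕ) (k : ℕ) (d : ℕ → ℕ)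
    (n v : ℕ) : delayedLoss ε u I k (Function.update d n v) ≤
      delayedLoss ε u I k d + u * groupLoss ε v := by
  have := mul_le_mul_of_nonneg_left
    (sum_update_le (s := I) d n v (f := groupLoss ε) (groupLoss_nonneg ε)) hu
  unfold delayedLoss
  linarith

/-- A slice is called at most once, so calling `i` uses up its own term. The additive loss
`groupLoss ε (d i)` of a call is paid by either part of `delayedLoss` alone, hence by their average.
-/
theorem DelayedAnalyst.approxLE_run {ε δ u : ℝ} (hε : 0 ≤ ε) (hδ : 0 ≤ δ) (hu : 0 ≤ u)
    (hu1 : u ≤ 1) {k : ℕ} (s : DelayedAnalyst X Y k) {I : Finset ℕ} (hs : s.Valid ε δ I)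
    {d : ℕ → ℕ} (hd : ∀ i, d i ≤ 2) {sl sl' : List (Multiset X)} (hsl : SlicesNear d sl sl') :
    ApproxLE (ε * ∑ i ∈ I, (d i : ℝ)) (delayedLoss ε u I k d * δ) (s.run sl) (s.run sl') := by
  induction s generalizing I with
  | done =>
    exact (ApproxLE.refl _).mono (by positivity) (mul_nonneg (delayedLoss_nonneg hu hu1 _ _ _) hδ)
  | @query k i A next ih =>
    have hs' := hs
    obtain ⟨hi, hA, hm, hnext⟩ := hs
    have := hA.isProbabilityMeasure (sl.getD i 0)
    rw [run_query, run_query]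
    refine ((hA.approxLE hε hδ (hsl.2 i)).consBind (hm sl) (hm sl')
      (fun r => (next r).isProbabilityMeasure_run (hnext r) sl)
      (fun r => (next r).isProbabilityMeasure_run (hnext r) sl')
      (fun r => ih r (hnext r)) (mul_nonneg (groupLoss_nonneg _ _) hδ)
      (mul_nonneg (delayedLoss_nonneg hu hu1 _ _ _) hδ)).mono ?_ ?_
    · rw [← Finset.add_sum_erase I _ hi, mul_add]
    · rw [← add_mul]
      refine mul_le_mul_of_nonneg_right ?_ hδ
      unfold delayedLoss
      rw [← Finset.add_sum_erase I _ hi]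
      have := mul_le_mul_of_nonneg_left (groupLoss_le_of_le_two (ε := ε) (hd i))
        (sub_nonneg.2 hu1)
      push_cast
      linarith

/-- Two executions on the same remaining dataset differ only in the stored slices. -/
theorem Analyst.approxLE_run_same {ε δ u : ℝ} (hε : 0 < ε) (hδ : 0 ≤ δ) (hu : 0 ≤ u)
    (hu1 : u ≤ 1) {τ ℓ k : ℕ} (a : Analyst X Y ℓ k) (ha : a.Valid τ ε δ) (D : Multiset X)
    {d : ℕ → ℕ} (hd : ∀ i, d i ≤ 2) {sl sl' : List (Multiset X)} (hsl : SlicesNear d sl sl') :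
    ApproxLE (ε * ∑ i ∈ Finset.range τ, (d i : ℝ))
      (delayedLoss ε u (Finset.range τ) ℓ d * δ) (a.run ε D sl) (a.run ε D sl') := by
  induction a generalizing D sl sl' with
  | delayed s => exact s.approxLE_run hε.le hδ hu hu1 ha hd hsl
  | query m A E next ih =>
    obtain ⟨hA, -, hm, hnext⟩ := ha
    rw [run_query, run_query]
    refine ((ApproxLE.refl (geomNoise ε)).bind Measurable.of_discrete Measurable.of_discrete
      (fun g => ?_) (fun g => ?_) le_rfl (mul_nonneg (delayedLoss_nonneg hu hu1 _ _ _) hδ)).mono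
      (zero_add _).le (zero_add _).le
    · have := hA.isProbabilityMeasure ((E D).take (m + g) : Multiset X)
      exact isProbabilityMeasure_consBind (hm _ _) fun r =>
        (next r).isProbabilityMeasure_run (hnext r) _ _
    · have := hA.isProbabilityMeasure ((E D).take (m + g) : Multiset X)
      exact ((ApproxLE.refl _).consBind (hm _ _) (hm _ _)
        (fun r => (next r).isProbabilityMeasure_run (hnext r) _ _)
        (fun r => (next r).isProbabilityMeasure_run (hnext r) _ _)
        (fun r => ih r (hnext r) _ (hsl.append_same _)) le_rfl
        (mul_nonneg (delayedLoss_nonneg hu hu1 _ _ _) hδ)).mono (zero_add _).le (zero_add _).le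

/-- The probability of a failed round, where the remaining datasets stay different
although the slices differ: `(1 - z) / (1 - z * y)` with `z = e^{-ε}`, and with `y = z` if
`z ≥ 2 / 3` and `y = 0` otherwise. -/
noncomputable def failProb (z : ℝ) : ℝ :=
  (1 - z) / (1 - z * if 2 / 3 ≤ z then z else 0)

theorem failProb_nonneg {z : ℝ} (hz : 0 < z) (hz1 : z < 1) : 0 ≤ failProb z := by
  unfold failProb
  split_ifs
  · exact div_nonneg (by linarith) (by nlinarith)
  · simpa using hz1.le

theorem failProb_of_le {z : ℝ} (hz : 2 / 3 ≤ z) (hz1 : z < 1) : failProb z = 1 / (1 + z) := by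
  rw [failProb, if_pos hz, div_eq_div_iff (by nlinarith) (by linarith)]
  ring

theorem failProb_of_lt {z : ℝ} (hz : z < 2 / 3) : failProb z = 1 - z := by
  simp [failProb, if_neg hz.not_ge]

theorem failProb_le {z : ℝ} (hz : 1 / 3 ≤ z) (hz1 : z < 1) : failProb z ≤ 2 / 3 := by
  rcases le_or_gt (2 / 3) z with h | h
  · rw [failProb_of_le h hz1, div_le_iff₀ (by linarith)]
    linarith
  · rw [failProb_of_lt h]
    linarith

/-- A bound on the additive loss of `k` rounds, as a multiple of `δ`, that is consistent with the
recursion over the rounds. -/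
structure IsRoundLoss (ε u : ℝ) (V : ℕ → ℝ) : Prop where
  nonneg : ∀ k, 0 ≤ V k
  le_succ : ∀ k, V k ≤ V (k + 1)
  one_add_le_succ : ∀ k, 1 + u ≤ V (k + 1)
  recursion : ∀ k, failProb (Real.exp (-ε)) * (V k + (1 + u) * (1 + Real.exp ε)) +
    (1 - failProb (Real.exp (-ε))) * (1 + u) ≤ V (k + 1)

/-- Here `j` is the remaining allowance of failed rounds. The slices already cut are accounted for
by `d`, the rounds still to come by `V`. -/
theorem Analyst.approxLE_run {ε δ u : ℝ} (hε : 0 < ε) (hε1 : ε < 1) (hδ : 0 ≤ δ) (hu : 0 ≤ u)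
    (hu1 : u ≤ 1) {V : ℕ → ℝ} (hV : IsRoundLoss ε u V) {τ ℓ k : ℕ} (a : Analyst X Y ℓ k)
    (ha : a.Valid τ ε δ) (j : ℕ) {D D' : Multiset X} (hD : Near 1 D D')
    {d : ℕ → ℕ} (hd : ∀ i, d i ≤ 2) {sl sl' : List (Multiset X)} (hsl : SlicesNear d sl sl') :
    ApproxLE (ε * (∑ i ∈ Finset.range τ, (d i : ℝ) + 6 * j))
      ((2 / 3) ^ j + (V k + delayedLoss ε u (Finset.range τ) ℓ d) * δ)
      (a.run ε D sl) (a.run ε D' sl') := by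
  induction a generalizing j D D' d sl sl' with
  | delayed s =>
    refine (s.approxLE_run hε.le hδ hu hu1 ha hd hsl).mono ?_ ?_
    · gcongr
      have : (0 : ℝ) ≤ 6 * j := by positivity
      linarith
    · have := mul_nonneg (hV.nonneg 0) hδ
      have : (0 : ℝ) ≤ (2 / 3) ^ j := by positivity
      linarith
  | @query k m A E next ih =>
    have hprob := fun D sl => isProbabilityMeasure_run _ ha D sl
    cases j with
    | zero =>
      -- With no allowance left, the additive loss is at least 1.
      have := hprob D sl
      refine ApproxLE.of_one_le ?_
      have := mul_nonneg (add_nonneg (hV.nonneg (k + 1))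
        (delayedLoss_nonneg (ε := ε) hu hu1 (Finset.range τ) ℓ d)) hδ
      simpa using this
    | succ j =>
    rcases near_one.1 hD with rfl | hD
    · refine (approxLE_run_same hε hδ hu hu1 _ ha D hd hsl).mono ?_ ?_
      · gcongr
        have : (0 : ℝ) ≤ 6 * (j + 1 : ℕ) := by positivity
        linarith
      · have := mul_nonneg (hV.nonneg (k + 1)) hδ
        have : (0 : ℝ) ≤ (2 / 3) ^ (j + 1) := by positivity
        linarith
    obtain ⟨hA, hE, hm, hnext⟩ := ha
    set Δ := ∑ i ∈ Finset.range τ, (d i : ℝ) with hΔ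
    set Φ := delayedLoss ε u (Finset.range τ) ℓ d with hΦ
    have hΔ0 : 0 ≤ Δ := by positivity
    have hΦ0 : 0 ≤ Φ := delayedLoss_nonneg hu hu1 _ _ _
    have hVk := hV.nonneg k
    let step : Multiset X → Multiset X → List (Multiset X) → Measure (Fin (ℓ + k + 1) → Y) :=
      fun S D sl => consBind (A S) fun r => (next r).run ε D (sl ++ [S])
    have hp : ∀ r D sl, IsProbabilityMeasure ((next r).run ε D sl) :=
      fun r D sl => (next r).isProbabilityMeasure_run (hnext r) D sl
    have hdu : ∀ v, v ≤ 2 → ∀ i, Function.update d sl.length v i ≤ 2 := by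
      intro v hv i
      by_cases hi : i = sl.length
      · subst hi; simpa using hv
      · simpa [hi] using hd i
    have hΔu : ∀ v : ℕ, ∑ i ∈ Finset.range τ, (Function.update d sl.length v i : ℝ) ≤ Δ + v :=
      fun v => sum_update_le d _ v (f := fun n => (n : ℝ)) fun n => n.cast_nonneg
    have hΦu : ∀ v : ℕ, delayedLoss ε u (Finset.range τ) ℓ (Function.update d sl.length v) ≤
      Φ + u * groupLoss ε v := fun v => delayedLoss_update_le hu _ _ _ _ _
    have hdiffer : ∀ (S T T' : Multiset X), Near 1 T T' →
        ApproxLE (ε * (Δ + 6 * (j + 1 : ℕ))) ((2 / 3) ^ (j + 1) + (V k + Φ) * δ)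
          (step S T sl) (step S T' sl') := by
      intro S T T' hT
      have := hA.isProbabilityMeasure S
      exact ((ApproxLE.refl (A S)).consBind (hm _ _) (hm _ _) (fun r => hp r _ _)
        (fun r => hp r _ _) (fun r => ih r (hnext r) (j + 1) hT hd (hsl.append_same S)) le_rfl
        (by positivity)).mono (zero_add _).le (zero_add _).le
    -- One `ε` pays for the published result and one for a delayed call; the 4 has slack. The
    -- additive charges are 1 and `u`.
    have hsame : ∀ (S S' T : Multiset X), Near 1 S S' →
        ApproxLE (ε * (Δ + 4)) ((Φ + (1 + u)) * δ) (step S T sl) (step S' T sl') := by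
      intro S S' T hS
      have := hA.isProbabilityMeasure S
      refine ((hA.approxLE hε.le hδ hS).consBind (hm _ _) (hm _ _) (fun r => hp r _ _)
        (fun r => hp r _ _) (fun r => approxLE_run_same hε hδ hu hu1 (next r) (hnext r) T
          (hdu 1 (by norm_num)) (hsl.append hS)) (mul_nonneg (groupLoss_nonneg _ _) hδ)
        (mul_nonneg (delayedLoss_nonneg hu hu1 _ _ _) hδ)).mono ?_ ?_
      · rw [← mul_add]
        refine mul_le_mul_of_nonneg_left ?_ hε.le
        have := hΔu 1
        push_cast at this ⊢
        linarith
      · rw [← add_mul]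
        refine mul_le_mul_of_nonneg_right ?_ hδ
        have := hΦu 1
        rw [groupLoss_one] at this ⊢
        linarith
    -- Slices two elements apart cost `2ε` now and `2ε` in a delayed call. The factor `e^(2ε)` of
    -- the split completes the `6ε` of a failure.
    have hfail : ∀ (S S' T T' : Multiset X), Near 2 S S' → Near 1 T T' →
        ApproxLE (ε * (Δ + 6 * j + 4))
          ((2 / 3) ^ j + (V k + Φ + (1 + u) * (1 + Real.exp ε)) * δ)
          (step S T sl) (step S' T' sl') := by
      intro S S' T T' hS hT
      have := hA.isProbabilityMeasure S
      refine ((hA.approxLE hε.le hδ hS).consBind (hm _ _) (hm _ _) (fun r => hp r _ _)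
        (fun r => hp r _ _) (fun r => ih r (hnext r) j hT
          (hdu 2 le_rfl) (hsl.append hS)) (mul_nonneg (groupLoss_nonneg _ _) hδ) ?_).mono ?_ ?_
      · have := delayedLoss_nonneg (ε := ε) hu hu1 (Finset.range τ) ℓ
          (Function.update d sl.length 2)
        positivity
      · rw [← mul_add]
        refine mul_le_mul_of_nonneg_left ?_ hε.le
        have := hΔu 2
        push_cast at this ⊢
        linarith
      · have := mul_le_mul_of_nonneg_right (hΦu 2) hδ
        rw [groupLoss_two] at this ⊢
        linarith
    set z := Real.exp (-ε) with hz_def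
    have hz : 0 < z := Real.exp_pos _
    have hz1 : z < 1 := by rw [hz_def, Real.exp_lt_one_iff]; linarith
    have hzinv : z⁻¹ = Real.exp ε := by rw [hz_def, Real.exp_neg, inv_inv]
    have hz3 : 1 / 3 ≤ z := by
      rw [hz_def, Real.exp_neg, ← one_div]
      have := Real.exp_lt_exp.2 hε1
      have := Real.exp_one_lt_d9
      exact one_div_le_one_div_of_le (Real.exp_pos _) (by linarith)
    have hhead : ENNReal.ofReal ((2 / 3) ^ (j + 1) + (V k + Φ) * δ) ≤
        ENNReal.ofReal ((2 / 3) ^ (j + 1) + (V (k + 1) + Φ) * δ) := by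
      have := hV.le_succ k
      gcongr
    intro F hF
    rw [run_query, run_query, geomNoise_bind_apply hε _ hF, geomNoise_bind_apply hε _ hF]
    rcases hE D D' hD with hEq | hIns | hIns
    · rw [hEq]
      exact tsum_geomWeight_mul_le hz.le hz1 fun g =>
        (hdiffer _ _ _ Near.rfl F hF).trans (by gcongr)
    · obtain ⟨p, hle, hge⟩ := hIns.exists_index
      -- Truncated subtraction matters: if `m ≥ p`, every cut is already past the insertion point.
      refine tsum_geomWeight_mul_le_of_tail hz.le hz1 (p - m) (fun g hg => ?_) ?_
      · obtain ⟨h1, h2⟩ := hle (m + g) (by omega)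
        rw [h1]
        exact (hdiffer _ _ _ h2 F hF).trans (by gcongr)
      · refine tsum_geomWeight_mul_le_of_shift hz hz1
          (b := ENNReal.ofReal (Real.exp (ε * (Δ + 4)))) ?_ fun g => ?_
        · rw [hzinv, ← ENNReal.ofReal_mul (Real.exp_pos _).le, ← Real.exp_add]
          gcongr
          push_cast
          nlinarith
        · obtain ⟨h1, h2⟩ := hge (m + (g + (p - m))) (by omega)
          rw [h2, show m + (g + 1 + (p - m)) = m + (g + (p - m)) + 1 by ring]
          refine (hsame _ _ _ h1 F hF).trans ?_
          gcongr
          have := hV.one_add_le_succ k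
          have : (Φ + (1 + u)) * δ ≤ (V (k + 1) + Φ) * δ :=
            mul_le_mul_of_nonneg_right (by linarith) hδ
          have : (0 : ℝ) ≤ (2 / 3) ^ (j + 1) := by positivity
          linarith
    · obtain ⟨p, hle, hge⟩ := hIns.exists_index
      refine tsum_geomWeight_mul_le_of_tail hz.le hz1 (p - m) (fun g hg => ?_) ?_
      · obtain ⟨h1, h2⟩ := hle (m + g) (by omega)
        rw [h1]
        exact (hdiffer _ _ _ h2.symm_one F hF).trans (by gcongr)
      -- For small `ε` the choice `y = z` keeps the factor `2 - y` below `e^(2ε)`. For `z < 2 / 3`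
      -- one has `e^(2ε) ≥ 9 / 4`, so `y = 0` is affordable, and it lowers the failure weight to `1
      -- - z`.
      · refine tsum_geomWeight_mul_le_of_split hz.le hz1 (y := if 2 / 3 ≤ z then z else 0)
          (K := Real.exp (2 * ε))
          (r := (2 / 3) ^ j + (V k + Φ + (1 + u) * (1 + Real.exp ε)) * δ)
          (r' := (Φ + (1 + u)) * δ)
          (b := ENNReal.ofReal (Real.exp (ε * (Δ + 6 * j + 4)))) ?_ ?_ ?_ ?_ ?_ ?_ ?_
          (fun g => ?_) (fun g => ?_)
        · split_ifs <;> linarith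
        · split_ifs <;> linarith
        · have hx : Real.exp ε * z = 1 := by rw [← hzinv, inv_mul_cancel₀ hz.ne']
          have hx2 : Real.exp (2 * ε) = Real.exp ε ^ 2 := by
            rw [← Real.exp_nat_mul]; norm_num
          rw [hx2]
          have hx0 := Real.exp_pos ε
          split_ifs with h
          · have : 1 ≤ Real.exp ε := Real.one_le_exp hε.le
            nlinarith [sq_nonneg (Real.exp ε - 1)]
          · have : 3 / 2 ≤ Real.exp ε := by
              push Not at h
              nlinarith
            nlinarith
        · rw [← ENNReal.ofReal_mul (Real.exp_pos _).le, ← Real.exp_add]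
          gcongr
          push_cast
          linarith
        · positivity
        · positivity
        · have hβ := hV.recursion k
          have hβ1 := failProb_le hz3 hz1
          rw [← hz_def] at hβ
          change failProb z * _ + (1 - failProb z) * _ ≤ _
          have h1 := mul_le_mul_of_nonneg_right hβ hδ
          have h2 : failProb z * (2 / 3) ^ j ≤ (2 / 3) ^ (j + 1) := by
            rw [pow_succ']
            gcongr
          linarith
        · obtain ⟨h1, h2⟩ := hIns.near (m + (g + (p - m)))
          refine (hfail _ _ _ _ h1 h2 F hF)
        · obtain ⟨h1, h2⟩ := hge (m + (g + (p - m))) (by omega)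
          rw [show m + (g + 1 + (p - m)) = m + (g + (p - m)) + 1 by ring, ← h2]
          refine (hsame _ _ _ h1.symm_one F hF).trans ?_
          gcongr
          have : (0 : ℝ) ≤ 6 * j := by positivity
          linarith

end Run

/-! ### Solutions of the recursion for the additive loss -/

section RoundLoss

variable {ε : ℝ}

theorem exp_neg_mul_exp (ε : ℝ) : Real.exp (-ε) * Real.exp ε = 1 := by
  rw [← Real.exp_add, neg_add_cancel, Real.exp_zero]

theorem exp_neg_mem (hε : 0 < ε) (hε1 : ε < 1) :
    1 / 3 ≤ Real.exp (-ε) ∧ Real.exp (-ε) < 1 ∧ 1 < Real.exp ε ∧ Real.exp ε ≤ 2.72 := by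
  have h1 : 1 < Real.exp ε := Real.one_lt_exp_iff.2 hε
  have h2 := (Real.exp_lt_exp.2 hε1).trans Real.exp_one_lt_d9
  have h3 := exp_neg_mul_exp ε
  refine ⟨by nlinarith, by nlinarith, h1, by linarith⟩

/-- Each round is charged as if it failed. -/
theorem isRoundLoss_linear (hε : 0 < ε) (hε1 : ε < 1) :
    IsRoundLoss ε 0 fun k => (1 + Real.exp ε) * k := by
  obtain ⟨hz3, hz1, hx1, -⟩ := exp_neg_mem hε hε1
  have hβ0 := failProb_nonneg (Real.exp_pos (-ε)) hz1
  have hβ1 := failProb_le hz3 hz1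
  refine ⟨fun k => by positivity, fun k => ?_, fun k => ?_, fun k => ?_⟩
  · push_cast; nlinarith
  · have : (0 : ℝ) ≤ (1 + Real.exp ε) * k := by positivity
    push_cast; nlinarith
  · have : (0 : ℝ) ≤ (1 + Real.exp ε) * k := by positivity
    push_cast
    nlinarith

/-- With failure weight `β`, a round adds at most `1 + β e^ε` on average, and `β ≤ z = e^(-ε)`: this
is `1 ≤ z + z²` for `z ≥ 2 / 3`, and `1 - z ≤ z` otherwise, which uses `ε ≤ log 2`. -/
theorem isRoundLoss_two_mul (hε : 0 < ε) (hε2 : ε ≤ Real.log 2) :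
    IsRoundLoss ε 0 fun k => 2 * k := by
  have hε1 : ε < 1 := hε2.trans_lt (Real.log_two_lt_d9.trans (by norm_num))
  obtain ⟨hz3, hz1, hx1, -⟩ := exp_neg_mem hε hε1
  have hβ0 := failProb_nonneg (Real.exp_pos (-ε)) hz1
  have hβ1 := failProb_le hz3 hz1
  have hx2 : Real.exp ε ≤ 2 := by
    rw [← Real.exp_log (zero_lt_two (α := ℝ))]
    exact Real.exp_le_exp.2 hε2
  have hzx := exp_neg_mul_exp ε
  have hβz : failProb (Real.exp (-ε)) ≤ Real.exp (-ε) := by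
    rcases le_or_gt (2 / 3) (Real.exp (-ε)) with h | h
    · rw [failProb_of_le h hz1, div_le_iff₀ (by linarith)]
      nlinarith
    · rw [failProb_of_lt h]
      nlinarith
  have hβx : failProb (Real.exp (-ε)) * Real.exp ε ≤ 1 := by
    rw [← hzx]
    gcongr
  refine ⟨fun k => by positivity, fun k => ?_, fun k => ?_, fun k => ?_⟩
  · push_cast; linarith
  · have : (0 : ℝ) ≤ k := by positivity
    push_cast; linarith
  · have : (0 : ℝ) ≤ k := by positivity
    push_cast
    nlinarith

/-- For the constant 16 the recursion reads `β (8 + e^ε) ≤ 7`, which the bounds on the failure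
weight `β` allow. -/
theorem isRoundLoss_const (hε : 0 < ε) (hε1 : ε < 1) : IsRoundLoss ε 1 fun _ => 16 := by
  obtain ⟨hz3, hz1, hx1, hx3⟩ := exp_neg_mem hε hε1
  have hzx := exp_neg_mul_exp ε
  have hβ : failProb (Real.exp (-ε)) * (8 + Real.exp ε) ≤ 7 := by
    rcases le_or_gt (2 / 3) (Real.exp (-ε)) with h | h
    · rw [failProb_of_le h hz1, div_mul_eq_mul_div, div_le_iff₀ (by linarith)]
      nlinarith
    · rw [failProb_of_lt h]
      have : Real.exp ε ≤ 8 * Real.exp (-ε) := by nlinarith [Real.exp_pos (-ε)]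
      nlinarith
  refine ⟨fun k => by norm_num, fun k => le_rfl, fun k => by norm_num, fun k => ?_⟩
  linarith

end RoundLoss

/-! ### From the family of guarantees to the theorem -/

/-- Passing to complements reverses the comparison and trades the multiplicative loss for an
additive one. This serves `δhat` near 1, where `log (1 / δhat)` is too small to pay for `j ≥ 1`. -/
theorem ApproxLE.of_symm {Z : Type*} [MeasurableSpace Z] {P Q : Measure Z}
    [IsProbabilityMeasure P] [IsProbabilityMeasure Q] {s d : ℝ} (h : ApproxLE s d Q P)
    (hs : 0 ≤ s) (hd : 0 ≤ d) : ApproxLE 0 (1 - Real.exp (-s) * (1 - d)) P Q := by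
  intro F hF
  have h1 := h Fᶜ hF.compl
  rw [← ofReal_measureReal, ← ofReal_measureReal (μ := P), ← ENNReal.ofReal_mul (Real.exp_pos s).le,
    ← ENNReal.ofReal_add (by positivity) hd, ENNReal.ofReal_le_ofReal_iff (by positivity),
    probReal_compl_eq_one_sub hF, probReal_compl_eq_one_sub hF] at h1
  rw [Real.exp_zero, ENNReal.ofReal_one, one_mul, ← ofReal_measureReal,
    ← ofReal_measureReal (μ := Q)]
  refine (ENNReal.ofReal_le_ofReal ?_).trans ENNReal.ofReal_add_le
  have h2 : Real.exp (-s) ≤ 1 := Real.exp_le_one_iff.2 (by linarith)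
  have h3 := mul_le_mul_of_nonneg_left h1 (Real.exp_pos (-s)).le
  have h4 : Real.exp (-s) * (Real.exp s * (1 - P.real F) + d) =
      1 - P.real F + Real.exp (-s) * d := by
    rw [mul_add, ← mul_assoc, exp_neg_mul_exp, one_mul]
  have h5 : Real.exp (-s) * Q.real F ≤ Q.real F :=
    mul_le_of_le_one_left measureReal_nonneg h2
  linarith

/-- From a family of guarantees whose multiplicative losses grow linearly and whose additive
losses decay geometrically, to a guarantee for every additive loss. -/
theorem isDP_of_forall_approxLE {X : Type u} {Z : Type w} [MeasurableSpace Z]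
    {M : Multiset X → Measure Z} {ε κ δhat : ℝ} (hM : ∀ D, IsProbabilityMeasure (M D))
    (hε : 0 < ε) (hε1 : ε < 1) (hκ : 0 ≤ κ) (hδ : 0 < δhat)
    (h : ∀ (j : ℕ) (D D' : Multiset X), Adjacent D D' →
      ApproxLE (ε * (6 * j)) ((2 / 3) ^ j + κ) (M D) (M D')) :
    IsDP M (6 * (1 / Real.log (3 / 2) + 2 * Real.exp 12) * ε * Real.log (1 / δhat))
      (δhat + κ) := by
  refine ⟨hM, fun D D' hD => ?_⟩
  change ApproxLE _ _ _ _
  have := hM D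
  have := hM D'
  have hlog : 0 < Real.log (3 / 2) := Real.log_pos (by norm_num)
  rcases le_or_gt 1 δhat with h1 | h1
  · exact ApproxLE.of_one_le (by linarith)
  have hL : 0 ≤ Real.log (1 / δhat) := Real.log_nonneg (by rw [le_div_iff₀ hδ]; linarith)
  -- Below the threshold `log (1 / δhat)` is bounded away from 0, which absorbs the rounding of `j`.
  -- Above it, complements with `j = 2` suffice: `12ε ≤ 12` and `1 - (2 / 3)^2 ≥ 1 / 2`.
  rcases le_or_gt δhat (1 - Real.exp (-12) / 2) with h2 | h2
  · set L := Real.log (1 / δhat) with hL_def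
    have hL1 : Real.exp (-12) / 2 ≤ L := by
      have := Real.log_le_sub_one_of_pos hδ
      rw [hL_def, one_div, Real.log_inv]
      linarith
    set j := ⌈L / Real.log (3 / 2)⌉₊
    have hj : L / Real.log (3 / 2) ≤ j := Nat.le_ceil _
    have hj' : (j : ℝ) ≤ L / Real.log (3 / 2) + 1 :=
      (Nat.ceil_lt_add_one (by positivity)).le
    refine (h j D D' hD).mono ?_ ?_
    · have h3 : 1 ≤ 2 * Real.exp 12 * L := by
        have h4 := exp_neg_mul_exp 12
        have h5 := mul_le_mul_of_nonneg_left hL1 (Real.exp_pos 12).le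
        linarith
      calc ε * (6 * j) ≤ ε * (6 * (L / Real.log (3 / 2) + 2 * Real.exp 12 * L)) := by
            gcongr; linarith
        _ = _ := by ring
    · gcongr
      rw [div_le_iff₀ hlog] at hj
      rw [← Real.exp_log hδ, show (2 / 3 : ℝ) = (3 / 2)⁻¹ by norm_num,
        ← Real.exp_log (show (0 : ℝ) < (3 / 2)⁻¹ by norm_num), ← Real.exp_nat_mul, Real.log_inv]
      apply Real.exp_le_exp.2
      rw [hL_def, one_div, Real.log_inv] at hj
      linarith
  · refine ((h 2 D' D hD.symm).of_symm (by positivity) (by positivity)).mono (by positivity) ?_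
    have h3 : Real.exp (-12) ≤ Real.exp (-(ε * (6 * (2 : ℕ)))) := by
      apply Real.exp_le_exp.2
      push_cast
      linarith
    have h4 : Real.exp (-(ε * (6 * (2 : ℕ)))) ≤ 1 := by
      rw [Real.exp_le_one_iff]
      push_cast
      linarith
    generalize Real.exp (-(ε * (6 * (2 : ℕ)))) = b at h3 h4 ⊢
    have h5 := mul_le_mul_of_nonneg_right h4 hκ
    linarith [Real.exp_pos (-12)]

theorem isDP_reorderSliceCompute {X : Type u} {Y : Type v} [MeasurableSpace Y] {τ ℓ : ℕ}
    {ε δ δhat u κ : ℝ} (hε : 0 < ε) (hε1 : ε < 1) (hδ : 0 ≤ δ) (hδhat : 0 < δhat) (hu : 0 ≤ u)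
    (hu1 : u ≤ 1) {V : ℕ → ℝ} (hV : IsRoundLoss ε u V) (analyst : Analyst X Y ℓ τ)
    (ha : analyst.Valid τ ε δ)
    (hκ : (V τ + (1 - u) * (ℓ * (1 + Real.exp ε))) * δ ≤ κ) :
    IsDP (reorderSliceCompute ε analyst)
      (6 * (1 / Real.log (3 / 2) + 2 * Real.exp 12) * ε * Real.log (1 / δhat)) (δhat + κ) := by
  have hκ0 : 0 ≤ (V τ + (1 - u) * (ℓ * (1 + Real.exp ε))) * δ := by
    have := hV.nonneg τ
    have : 0 ≤ 1 - u := by linarith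
    positivity
  refine isDP_of_forall_approxLE (fun D => analyst.isProbabilityMeasure_run ha D []) hε hε1
    (hκ0.trans hκ) hδhat fun j D D' hD => ?_
  refine (analyst.approxLE_run hε hε1 hδ hu hu1 hV ha j (near_one.2 (Or.inr hD))
    (d := fun _ => 0) (by simp) (sl := []) (sl' := []) ⟨rfl, fun i => Near.rfl⟩).mono ?_ ?_
  · simp
  · simpa [delayedLoss, groupLoss_zero] using hκ

end ReorderSliceCompute

theorem mainTheorem1 :
    ∃ C : ℝ, 0 < C ∧
      ∀ (X : Type u) (Y : Type v) [MeasurableSpace Y] (τ ℓ : ℕ) (ε δ δhat : ℝ),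
        1 ≤ τ → ℓ ≤ τ → 0 < ε → ε < 1 → 0 ≤ δ → δ < 1 → 0 < δhat →
        ∀ analyst : ReorderSliceCompute.Analyst X Y ℓ τ, analyst.Valid τ ε δ →
          ReorderSliceCompute.IsDP (ReorderSliceCompute.reorderSliceCompute ε analyst)
            (C * ε * Real.log (1 / δhat)) (δhat + (1 + Real.exp ε) * (τ + ℓ) * δ) ∧
          ((8 ≤ τ ∨ (ℓ = 0 ∧ ε ≤ Real.log 2)) →
            ReorderSliceCompute.IsDP (ReorderSliceCompute.reorderSliceCompute ε analyst)
              (C * ε * Real.log (1 / δhat)) (δhat + 2 * τ * δ)) := by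
  have hlog : 0 < Real.log (3 / 2) := Real.log_pos (by norm_num)
  refine ⟨6 * (1 / Real.log (3 / 2) + 2 * Real.exp 12), by positivity, ?_⟩
  intro X Y _ τ ℓ ε δ δhat _ _ hε hε1 hδ _ hδhat analyst ha
  refine ⟨?_, ?_⟩
  · refine ReorderSliceCompute.isDP_reorderSliceCompute hε hε1 hδ hδhat le_rfl zero_le_one
      (ReorderSliceCompute.isRoundLoss_linear hε hε1) analyst ha (le_of_eq ?_)
    ring
  · rintro (hτ | ⟨rfl, hε2⟩)
    · refine ReorderSliceCompute.isDP_reorderSliceCompute hε hε1 hδ hδhat zero_le_one le_rfl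
        (ReorderSliceCompute.isRoundLoss_const hε hε1) analyst ha ?_
      -- With `u = 1` the separate term for delayed calls vanishes and only `16 ≤ 2τ` remains.
      have : (8 : ℝ) ≤ τ := by exact_mod_cast hτ
      refine mul_le_mul_of_nonneg_right ?_ hδ
      linarith
    · refine ReorderSliceCompute.isDP_reorderSliceCompute hε hε1 hδ hδhat le_rfl zero_le_one
        (ReorderSliceCompute.isRoundLoss_two_mul hε hε2) analyst ha (le_of_eq ?_)
      simp
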